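/- **Proposition 5.2 (Kontsevich's formula for a constant Poisson structure gives the Moyal product).** *Setting.* A Poisson structure on $\mathbb{R}^d$ is a skew-symmetric smooth bivector field $\pi=(\pi^{ij})$ whose bracket $\{f,g\}=\sum_{i,j}\pi^{ij}\,\partial_i f\,\partial_j g$ on $C^\infty(\mathbb{R}^d)$ satisfies the Jacobi identity. For $n\ge 0$ let $G_n$ be the finite set of admissible graphs of order $n$: directed graphs on the vertices $1,\dots,n,L,R$ with $2n$ labelled edges $e_1^1,e_1^2,\dots,e_n^1,e_n^2$, where $e_k^1$ and $e_k^2$ start at $k$ and end at two different vertices, both different from $k$. For $\Gamma\in G_n$ put $$B_{\Gamma,\pi}(f,g)=\sum_{I}\Big[\prod_{k=1}^n\Big(\prod_{e=(*,k)}\partial_{I(e)}\Big)\pi^{I(e_k^1)I(e_k^2)}\Big]\Big(\prod_{e=(*,L)}\partial_{I(e)}\Big)f\;\Big(\prod_{e=(*,R)}\partial_{I(e)}\Big)g,$$ where $I$ runs over all maps from the edges of $\Gamma$ to $\{1,\dots,d\}$. Let $\mathcal H=\{\operatorname{Im} z>0\}$, let $\mathcal H_n\subset\mathcal H^n$ be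 the set of $n$-tuples $(p_1,\dots,p_n)$ of pairwise distinct points with the orientation $dx_1\wedge dy_1\wedge\dots\wedge dx_n\wedge dy_n$, and let $\phi(p,q)=\frac1{2\pi}\arg\frac{q-p}{q-\bar p}$, an angle defined modulo $1$. Place the vertex $k$ at $p_k$, $L$ at $0$ and $R$ at $1$; an edge $e$ from $p$ to $q$ gives the angle $\phi_e=\phi(p,q)$ and the $1$-form $d\phi_e$ on $\mathcal H_n$. The weight of $\Gamma$ is $$\omega_\Gamma=\int_{\mathcal H_n}d\phi_{e_1^1}\wedge d\phi_{e_1^2}\wedge\dots\wedge d\phi_{e_n^1}\wedge d\phi_{e_n^2}.$$ Kontsevich's product on $C^\infty(\mathbb{R}^d)[\![\hbar]\!]$ is the $\mathbb{R}[\![\hbar]\!]$-bilinear extension $$F\star G=\sum_{n,a,b\ge 0}\hbar^{n+a+b}B_n(F_a,G_b),\qquad F=\sum_a F_a\hbar^a,\quad G=\sum_b G_b\hbar^b,$$ of $$f\star g=\sum_{n\ge 0}\hbar^n B_n(f,g),\qquad B_n(f,g)=\frac1{n!}\sum_{\Gamma\in G_n}\omega_\Gamma B_{\Gamma,\pi}(f,g),\qquad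 f,g\in C^\infty(\mathbb{R}^d).$$ *Statement.* Let $\pi$ be a constant Poisson structure on $\mathbb{R}^d$, i.e. $\pi^{ij}=\alpha^{ij}$ with $\alpha^{ij}\in\mathbb{R}$ for all $i,j$. Then Kontsevich's product is the Moyal product: for all $f,g\in C^\infty(\mathbb{R}^d)$, $$f\star g=\sum_{n\ge 0}\frac{\hbar^n}{n!}M_n(f,g),\qquad M_n(f,g)=\sum_{\substack{1\le i_1,\dots,i_n\le d\\ 1\le j_1,\dots,j_n\le d}}\Big(\prod_{k=1}^n\alpha^{i_kj_k}\Big)\Big(\prod_{k=1}^n\partial_{i_k}f\Big)\Big(\prod_{k=1}^n\partial_{j_k}g\Big),$$ where $\prod_k\partial_{i_k}f$ denotes the iterated partial derivative $\partial_{i_1}\cdots\partial_{i_n}f$, and Kontsevich's product agrees with the $\mathbb{R}[\![\hbar]\!]$-bilinear extension of the right-hand side (in the same sense as above) on all of $C^\infty(\mathbb{R}^d)[\![\hbar]\!]$. More precisely, for every $n\ge 0$: 1. if some edge of $\Gamma\in G_n$ ends at a vertex other than $L$ and $R$, then $B_{\Gamma,\pi}=0$; 2. exactly $2^n$ graphs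 in $G_n$ have all their edges ending at $L$ or $R$; 3. for each such graph $\Gamma$ the integral defining $\omega_\Gamma$ converges absolutely, and $$\omega_\Gamma=(-1)^{s(\Gamma)}\,(\omega_{\Gamma_1})^n=(-1)^{s(\Gamma)}\Big(\frac12\Big)^n,$$ where $s(\Gamma)$ is the number of $k$ for which $e_k^1$ ends at $R$ and $\Gamma_1\in G_1$ is the graph with $e_1^1=(1,L)$, $e_1^2=(1,R)$; 4. each such graph makes the same contribution, $\omega_\Gamma B_{\Gamma,\pi}(f,g)=2^{-n}M_n(f,g)$ for all $f,g\in C^\infty(\mathbb{R}^d)$. -/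

import Mathlib

open MeasureTheory
open scoped Manifold ContDiff

noncomputable section

namespace Kontsevich

/-! ### Smooth functions on `ℝ^d`, partial derivatives, Poisson structures -/

/-- `ℝ^d`. -/
abbrev Space (d : ℕ) : Type := EuclideanSpace ℝ (Fin d)

/-- The commutative `ℝ`-algebra `C^∞(ℝ^d)` of smooth real functions. -/
abbrev Smooth (d : ℕ) : Type := C^∞⟮𝓘(ℝ, Space d), Space d; 𝓘(ℝ, ℝ), ℝ⟯

/-- The partial derivative `∂_i f` of a smooth function, again a smooth function. -/
def pderiv {d : ℕ} (i : Fin d) (f : Smooth d) : Smooth d :=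
  ⟨fun x => fderiv ℝ (fun y => f y) x (EuclideanSpace.single i (1 : ℝ)), by
    have hf : ContDiff ℝ ∞ (fun y => f y) := f.contMDiff.contDiff
    exact ((hf.fderiv_right (m := ∞) (by simp)).clm_apply contDiff_const).contMDiff⟩

/-- The iterated partial derivative `∂_{i₁} ∂_{i₂} ⋯ ∂_{iₘ} f` for the list `[i₁, …, iₘ]`.
Partial derivatives of smooth functions commute, so the order of the list is immaterial. -/
def pderivs {d : ℕ} (l : List (Fin d)) (f : Smooth d) : Smooth d :=
  l.foldr pderiv f

/-- A Poisson structure on `ℝ^d`: a skew-symmetric smooth bivector field `(π^{ij})` whose bracket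
`{f, g} = ∑ π^{ij} ∂_i f ∂_j g` satisfies the Jacobi identity. (Bilinearity, antisymmetry and the
Leibniz rule of the bracket are automatic.) -/
structure PoissonStructure (d : ℕ) where
  /-- the components `π^{ij}` of the bivector field -/
  coeff : Fin d → Fin d → Smooth d
  skew : ∀ i j, coeff i j = -coeff j i
  jacobi : ∀ f g h : Smooth d,
    let br : Smooth d → Smooth d → Smooth d :=
      fun u v => ∑ i, ∑ j, coeff i j * pderiv i u * pderiv j v
    br f (br g h) + br g (br h f) + br h (br f g) = 0

/-! ### Admissible graphs -/

/-- The vertices `1, …, n, L, R`. -/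
abbrev Vertex (n : ℕ) : Type := Fin n ⊕ Fin 2

/-- The vertex `L`. -/
abbrev Vertex.L {n : ℕ} : Vertex n := Sum.inr 0

/-- The vertex `R`. -/
abbrev Vertex.R {n : ℕ} : Vertex n := Sum.inr 1

/-- The labels of the `2n` edges: `(k, 0)` and `(k, 1)` stand for `e_k^1` and `e_k^2`. -/
abbrev EdgeLabel (n : ℕ) : Type := Fin n × Fin 2

/-- The set `G_n` of admissible graphs: the edge labelled `(k, a)` starts at the vertex `k` and
ends at `Γ.1 (k, a)`; the two edges that start at `k` end at different vertices, and no edge is a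
loop. -/
def AdmissibleGraph (n : ℕ) : Type :=
  {t : EdgeLabel n → Vertex n //
    ∀ k : Fin n, t (k, 0) ≠ t (k, 1) ∧ ∀ a : Fin 2, t (k, a) ≠ Sum.inl k}

instance (n : ℕ) : Fintype (AdmissibleGraph n) := by
  unfold AdmissibleGraph; infer_instance

namespace AdmissibleGraph

variable {n d : ℕ}

/-- The endpoint of an edge. -/
def target (Γ : AdmissibleGraph n) (e : EdgeLabel n) : Vertex n := Γ.1 e

/-- All edges end at `L` or `R`. -/
def AllEdgesToLR (Γ : AdmissibleGraph n) : Prop :=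
  ∀ e : EdgeLabel n, Γ.target e = Vertex.L ∨ Γ.target e = Vertex.R

/-- The number of vertices whose first edge `e_k^1` ends at `R`. -/
def numSwapped (Γ : AdmissibleGraph n) : ℕ :=
  (Finset.univ.filter fun k : Fin n => Γ.target (k, 0) = Vertex.R).card

/-- The list of the edges ending at `v`, in the order `e_1^1, e_1^2, …, e_n^1, e_n^2`. -/
def inEdges (Γ : AdmissibleGraph n) (v : Vertex n) : List (EdgeLabel n) :=
  (List.finRange n ×ˢ List.finRange 2).filter fun e => Γ.target e = v

/-- The bidifferential operator `B_{Γ,π}`: the sum over all labellings `I` of the edges by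
coordinate indices of
`∏_k (∏_{e = (*, k)} ∂_{I(e)}) π^{I(e_k^1) I(e_k^2)}` times
`(∏_{e = (*, L)} ∂_{I(e)}) f` times `(∏_{e = (*, R)} ∂_{I(e)}) g`. -/
def bidiff (Γ : AdmissibleGraph n) (P : PoissonStructure d) (f g : Smooth d) : Smooth d :=
  ∑ I : EdgeLabel n → Fin d,
    (∏ k : Fin n,
      pderivs ((Γ.inEdges (Sum.inl k)).map I) (P.coeff (I (k, 0)) (I (k, 1)))) *
    pderivs ((Γ.inEdges Vertex.L).map I) f * pderivs ((Γ.inEdges Vertex.R).map I) g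

/-- The graph whose edges `e_k^1` all end at `L` and whose edges `e_k^2` all end at `R`. -/
def moyal (n : ℕ) : AdmissibleGraph n :=
  ⟨fun e => Sum.inr e.2, fun _ => ⟨by simp, by simp⟩⟩

end AdmissibleGraph

/-! ### Weights -/

/-- The space `ℋ_n` of configurations of `n` pairwise distinct points in the upper half plane. -/
def configSpace (n : ℕ) : Set (Fin n → ℂ) :=
  {p | (∀ k, 0 < (p k).im) ∧ Function.Injective p}

/-- The position of a vertex: `p_k` for the vertex `k`, and `0`, `1` for `L`, `R`. -/
def position {n : ℕ} (p : Fin n → ℂ) : Vertex n → ℂ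
  | Sum.inl k => p k
  | Sum.inr a => if a = 0 then 0 else 1

/-- `(q - p) / (q - conj p)`, whose argument is the angle between `p` and `q`. -/
def angleRatio (p q : ℂ) : ℂ := (q - p) / (q - (starRingEnd ℂ) p)

/-- The normalised angle `φ(p, q) = (1 / 2π) arg ((q - p) / (q - conj p))`. -/
def angle (p q : ℂ) : ℝ := (1 / (2 * Real.pi)) * Complex.arg (angleRatio p q)

namespace AdmissibleGraph

variable {n : ℕ}

/-- The function `(p_1, …, p_n) ↦ (q - p) / (q - conj p)`, with `p`, `q` the positions of the two
ends of the edge `e`. -/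
def edgeRatio (Γ : AdmissibleGraph n) (e : EdgeLabel n) (p : Fin n → ℂ) : ℂ :=
  angleRatio (p e.1) (position p (Γ.target e))

/-- The `1`-form `dφ_e` on `ℋ_n`. Since `φ_e` is an angle, i.e. is defined modulo `1`, its
differential is written as `(1 / 2π) d arg u = (1 / 2π) Im (du / u)` with `u = edgeRatio Γ e`; this
smooth form does not see the branch cut of `arg`. See `hasFDerivAt_angle`. -/
def dAngle (Γ : AdmissibleGraph n) (e : EdgeLabel n) (p : Fin n → ℂ) : (Fin n → ℂ) →L[ℝ] ℝ :=
  (1 / (2 * Real.pi)) •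
    Complex.imCLM.comp ((Γ.edgeRatio e p)⁻¹ • fderiv ℝ (Γ.edgeRatio e) p)

end AdmissibleGraph

/-- The wedge product of a finite family of `1`-forms, normalised so that
`(α_1 ∧ ⋯ ∧ α_m) (v_1, …, v_m) = det (α_j (v_i))`. -/
def wedge {ι E : Type*} [Fintype ι] [DecidableEq ι] [AddCommGroup E] [Module ℝ E]
    (α : ι → E →ₗ[ℝ] ℝ) : E [⋀^ι]→ₗ[ℝ] ℝ :=
  (Matrix.detRowAlternating (n := ι) (R := ℝ)).compLinearMap (LinearMap.pi α)

/-- The real frame `∂/∂x_1, ∂/∂y_1, …, ∂/∂x_n, ∂/∂y_n` of `ℂ^n`, positively oriented for the complex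
structure. Both this frame and the edges are indexed by `Fin n × Fin 2`, listed in the same
(lexicographic) order. -/
def frame (n : ℕ) (e : Fin n × Fin 2) : Fin n → ℂ :=
  Pi.single e.1 (if e.2 = 0 then 1 else Complex.I)

namespace AdmissibleGraph

variable {n d : ℕ}

/-- The `2n`-form `dφ_{e_1^1} ∧ dφ_{e_1^2} ∧ ⋯ ∧ dφ_{e_n^1} ∧ dφ_{e_n^2}`. -/
def weightForm (Γ : AdmissibleGraph n) (p : Fin n → ℂ) : (Fin n → ℂ) [⋀^EdgeLabel n]→ₗ[ℝ] ℝ :=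
  wedge fun e => (Γ.dAngle e p).toLinearMap

/-- The weight `ω_Γ`, the integral of the `2n`-form over `ℋ_n` with the orientation
`dx_1 ∧ dy_1 ∧ ⋯ ∧ dx_n ∧ dy_n`. -/
def weight (Γ : AdmissibleGraph n) : ℝ :=
  ∫ p in configSpace n, Γ.weightForm p (frame n)

/-- Away from the branch cut, `dφ_e` is the differential of `φ_e`. -/
theorem hasFDerivAt_angle (Γ : AdmissibleGraph n) (e : EdgeLabel n) {p : Fin n → ℂ}
    (hp : p ∈ configSpace n) (hcut : Γ.edgeRatio e p ∈ Complex.slitPlane) :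
    HasFDerivAt (fun q : Fin n → ℂ => angle (q e.1) (position q (Γ.target e))) (Γ.dAngle e p) p := by
  have hq : DifferentiableAt ℝ (fun q : Fin n → ℂ => position q (Γ.target e)) p := by
    rcases Γ.target e with k | a
    · simp only [position]; fun_prop
    · simp only [position]; fun_prop
  have hc : DifferentiableAt ℝ (fun q : Fin n → ℂ => (starRingEnd ℂ) (q e.1)) p :=
    Complex.conjCLE.differentiableAt.comp p (by fun_prop)
  have hne : position p (Γ.target e) - (starRingEnd ℂ) (p e.1) ≠ 0 := by
    intro h
    have him := congrArg Complex.im h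
    have h1 := hp.1 e.1
    rcases hv : Γ.target e with k | a
    · have h2 := hp.1 k
      simp [hv, position] at him
      linarith
    · have h2 : (position p (Sum.inr a : Vertex n)).im = 0 := by
        simp only [position]; split_ifs <;> simp
      simp [hv, h2] at him
      linarith
  have hd : DifferentiableAt ℝ (Γ.edgeRatio e) p := by
    have h1 : DifferentiableAt ℝ (fun q : Fin n → ℂ => q e.1) p := by fun_prop
    have h2 := (hq.sub h1).mul ((hq.sub hc).inv hne)
    exact h2.congr_of_eventuallyEq (Filter.Eventually.of_forall fun q => by
      simp [edgeRatio, angleRatio, div_eq_mul_inv])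
  have hD : Γ.dAngle e p = (1 / (2 * Real.pi)) • Complex.imCLM.comp
      (((Γ.edgeRatio e p)⁻¹ • (1 : ℂ →L[ℝ] ℂ)).comp (fderiv ℝ (Γ.edgeRatio e) p)) := by
    ext v
    simp [dAngle]
  rw [hD]
  have h := (Complex.imCLM.hasFDerivAt.comp p
    ((Complex.hasStrictFDerivAt_log_real hcut).hasFDerivAt.comp p hd.hasFDerivAt)).const_mul
      (1 / (2 * Real.pi))
  exact h.congr_of_eventuallyEq (Filter.Eventually.of_forall fun q => by
    simp [angle, edgeRatio, Complex.log_im])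

end AdmissibleGraph

/-! ### Star products -/

/-- The `ℝ⟦ħ⟧`-bilinear extension of `(f, g) ↦ ∑_n ħ^n B_n(f, g)` to formal power series:
the coefficient of `ħ^N` in `F ⋆ G` is `∑_{n + a + b = N} B_n (F_a, G_b)`. -/
def starProduct {A : Type*} [CommRing A] (B : ℕ → A → A → A) (F G : PowerSeries A) :
    PowerSeries A :=
  PowerSeries.mk fun N =>
    ∑ s ∈ Finset.HasAntidiagonal.antidiagonal N, ∑ t ∈ Finset.HasAntidiagonal.antidiagonal s.2,
      B s.1 (PowerSeries.coeff t.1 F) (PowerSeries.coeff t.2 G)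

variable {d : ℕ}

/-- The operator `B_n = (1 / n!) ∑_{Γ ∈ G_n} ω_Γ B_{Γ,π}` of Kontsevich's formula. -/
def kontsevichOp (P : PoissonStructure d) (n : ℕ) (f g : Smooth d) : Smooth d :=
  (1 / (n.factorial : ℝ)) • ∑ Γ : AdmissibleGraph n, Γ.weight • Γ.bidiff P f g

/-- Kontsevich's product on `C^∞(ℝ^d)⟦ħ⟧`. -/
def kontsevichStar (P : PoissonStructure d) (F G : PowerSeries (Smooth d)) :
    PowerSeries (Smooth d) :=
  starProduct (kontsevichOp P) F G

/-- `∑_{i, j} (∏_k α^{i_k j_k}) (∏_k ∂_{i_k} f) (∏_k ∂_{j_k} g)`, where `i` and `j` run over all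
`n`-tuples of coordinate indices. -/
def moyalTerm (α : Fin d → Fin d → ℝ) (n : ℕ) (f g : Smooth d) : Smooth d :=
  ∑ i : Fin n → Fin d, ∑ j : Fin n → Fin d,
    (∏ k, α (i k) (j k)) • (pderivs (List.ofFn i) f * pderivs (List.ofFn j) g)

/-- The operator at order `ħ^n` of the Moyal product. -/
def moyalOp (α : Fin d → Fin d → ℝ) (n : ℕ) (f g : Smooth d) : Smooth d :=
  (1 / (n.factorial : ℝ)) • moyalTerm α n f g

/-- The Moyal product on `C^∞(ℝ^d)⟦ħ⟧`. -/
def moyalStar (α : Fin d → Fin d → ℝ) (F G : PowerSeries (Smooth d)) : PowerSeries (Smooth d) :=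
  starProduct (moyalOp α) F G

end Kontsevich

end

open Kontsevich

/-! A derivative of a constant coefficient vanishes, so only graphs with all edges ending at `L` or
`R` contribute. In such a graph each vertex sends one edge to `L` and one to `R`; the graph is thus
a choice, at each vertex, of whether to swap the two edges (`ofSwaps`). A swap transposes the
indices of one factor `α`, which costs a sign by skew-symmetry, and exchanges two 1-forms in the
weight, which costs another. The signs cancel in `ω_Γ B_Γ`, so the `2 ^ n` graphs contribute equally
(`weight_smul_bidiff`).

For the weight, the two angles at vertex `k` depend on `p_k` alone, so the form is a product of
2-forms in separate variables (`weightForm_ofSwaps_frame`). The diagonals are null, and Fubini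
reduces everything to one vertex. For a real point `b`, the ratio `(b - p) / (b - conj p)` has
argument `2 arg (p - b)` modulo `2π`, so `dφ = (1 / π) d arg (p - b)`. Hence `ω_{Γ₁}` is `1 / π²`
times the area of the image of the half plane under `z ↦ (arg z, arg (z - 1))`. This map is an
orientation-preserving bijection onto the triangle `0 < a < b < π`, of area `π² / 2`, which gives `1
/ 2`. -/

namespace Kontsevich

/-! ### Graphs, bidifferential operators and star products -/

section Algebra

variable {n d : ℕ}

theorem pderiv_eq_zero_of_const {f : Smooth d} {c : ℝ} (hf : ∀ x, f x = c) (i : Fin d) :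
    pderiv i f = 0 := by
  ext x
  change fderiv ℝ (fun y => f y) x (EuclideanSpace.single i (1 : ℝ)) = 0
  rw [show (fun y => f y) = fun _ => c from funext hf]
  simp

theorem pderivs_zero (l : List (Fin d)) : pderivs l (0 : Smooth d) = 0 := by
  induction l with
  | nil => rfl
  | cons i t ih =>
    change pderiv i (pderivs t 0) = 0
    rw [ih]
    exact pderiv_eq_zero_of_const (c := 0) (fun _ => rfl) i

theorem pderivs_eq_zero_of_const {f : Smooth d} {c : ℝ} (hf : ∀ x, f x = c) {l : List (Fin d)}
    (hl : l ≠ []) : pderivs l f = 0 := by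
  induction l with
  | nil => exact absurd rfl hl
  | cons i t ih =>
    change pderiv i (pderivs t f) = 0
    by_cases ht : t = []
    · subst ht
      exact pderiv_eq_zero_of_const hf i
    · rw [ih ht]
      exact pderiv_eq_zero_of_const (c := 0) (fun _ => rfl) i

theorem PoissonStructure.skew_of_const {P : PoissonStructure d} {α : Fin d → Fin d → ℝ}
    (hP : ∀ (i j : Fin d) (x : Space d), P.coeff i j x = α i j) (i j : Fin d) :
    α i j = -α j i := by
  have h := congrArg (fun f : Smooth d => f 0) (P.skew i j)
  change P.coeff i j 0 = -(P.coeff j i 0) at h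
  rwa [hP, hP] at h

namespace AdmissibleGraph

theorem bidiff_eq_zero {P : PoissonStructure d} {α : Fin d → Fin d → ℝ}
    (hP : ∀ (i j : Fin d) (x : Space d), P.coeff i j x = α i j) {Γ : AdmissibleGraph n}
    (hΓ : ¬ Γ.AllEdgesToLR) (f g : Smooth d) : Γ.bidiff P f g = 0 := by
  obtain ⟨e, k, hk⟩ : ∃ e k, Γ.target e = Sum.inl k := by
    unfold AllEdgesToLR at hΓ
    push Not at hΓ
    obtain ⟨e, h0, h1⟩ := hΓ
    rcases h : Γ.target e with k | a
    · exact ⟨e, k, h⟩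
    · fin_cases a
      · exact absurd h h0
      · exact absurd h h1
  refine Finset.sum_eq_zero fun I _ => ?_
  -- The factor at `k`, the endpoint of `e`, is a constant differentiated at least once.
  rw [Finset.prod_eq_zero (Finset.mem_univ k), zero_mul, zero_mul]
  refine pderivs_eq_zero_of_const (hP _ _) ?_
  have : e ∈ Γ.inEdges (Sum.inl k) := by
    obtain ⟨l, a⟩ := e
    exact List.mem_filter.2 ⟨List.pair_mem_product.2 ⟨List.mem_finRange l, List.mem_finRange a⟩,
      decide_eq_true hk⟩
  intro h
  rw [List.map_eq_nil_iff] at h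
  simp [h] at this

/-- The graph with all edges ending at `L` or `R` in which the edges starting at `k` are swapped
when `s k = 1`. -/
def ofSwaps (s : Fin n → Fin 2) : AdmissibleGraph n :=
  ⟨fun e => Sum.inr (e.2 + s e.1), fun k => ⟨by simp, by simp⟩⟩

theorem target_ofSwaps (s : Fin n → Fin 2) (e : EdgeLabel n) :
    (ofSwaps s).target e = Sum.inr (e.2 + s e.1) := rfl

theorem ofSwaps_injective : Function.Injective (ofSwaps (n := n)) := by
  intro s t h
  funext k
  have := congrArg (fun Γ => Γ.target (k, 0)) h
  simpa [target_ofSwaps] using this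

theorem allEdgesToLR_ofSwaps (s : Fin n → Fin 2) : (ofSwaps s).AllEdgesToLR := by
  intro e
  rw [target_ofSwaps]
  generalize e.2 + s e.1 = a
  fin_cases a <;> simp

theorem AllEdgesToLR.exists_ofSwaps {Γ : AdmissibleGraph n} (h : Γ.AllEdgesToLR) :
    ∃ s, Γ = ofSwaps s := by
  have hs : ∀ e, ∃ a : Fin 2, Γ.target e = Sum.inr a := fun e =>
    (h e).elim (fun h => ⟨0, h⟩) (fun h => ⟨1, h⟩)
  choose t ht using hs
  -- The first edge decides the swap; the second must take the other of two values.
  refine ⟨fun k => t (k, 0), Subtype.ext (funext fun e => ?_)⟩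
  change Γ.target e = Sum.inr (e.2 + t (e.1, 0))
  obtain ⟨k, a⟩ := e
  have hne : t (k, 0) ≠ t (k, 1) := fun h' =>
    (Γ.2 k).1 ((ht (k, 0)).trans ((congrArg Sum.inr h').trans (ht (k, 1)).symm))
  rw [ht]
  congr 1
  revert hne
  fin_cases a
  · simp
  · change t (k, 0) ≠ t (k, 1) → t (k, 1) = 1 + t (k, 0)
    generalize t (k, 0) = u
    generalize t (k, 1) = v
    revert u v
    decide

theorem card_allEdgesToLR (n : ℕ) :
    Nat.card {Γ : AdmissibleGraph n // Γ.AllEdgesToLR} = 2 ^ n := by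
  have : Function.Bijective fun s : Fin n → Fin 2 =>
      (⟨ofSwaps s, allEdgesToLR_ofSwaps s⟩ : {Γ : AdmissibleGraph n // Γ.AllEdgesToLR}) :=
    ⟨fun s t h => ofSwaps_injective (congrArg Subtype.val h), fun ⟨Γ, hΓ⟩ => by
      obtain ⟨s, rfl⟩ := hΓ.exists_ofSwaps
      exact ⟨s, rfl⟩⟩
  rw [← Nat.card_congr (Equiv.ofBijective _ this)]
  simp

theorem neg_one_pow_numSwapped_ofSwaps (s : Fin n → Fin 2) :
    (-1 : ℝ) ^ (ofSwaps s).numSwapped = ∏ k, if s k = 0 then 1 else -1 := by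
  rw [Finset.prod_ite, Finset.prod_const_one, one_mul, Finset.prod_const, numSwapped]
  congr 2
  ext k
  simp only [target_ofSwaps, Finset.mem_filter, Finset.mem_univ, true_and, Sum.inr.injEq, zero_add]
  generalize s k = u
  revert u
  decide

theorem inEdges_ofSwaps_inl (s : Fin n → Fin 2) (k : Fin n) :
    (ofSwaps s).inEdges (Sum.inl k) = [] := by
  simp [inEdges, target_ofSwaps]

/-- Every element of `Fin 2` is its own negative, so `a + s k = b` has the unique solution `a = b +
s k`. The order of the list matches `List.ofFn`, so derivatives need not be commuted later. -/
theorem inEdges_ofSwaps_inr (s : Fin n → Fin 2) (b : Fin 2) :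
    (ofSwaps s).inEdges (Sum.inr b) = (List.finRange n).map fun k => (k, b + s k) := by
  simp only [inEdges, target_ofSwaps, Sum.inr.injEq]
  generalize List.finRange n = l
  induction l with
  | nil => rfl
  | cons k t ih =>
    rw [List.product_cons, List.filter_append, ih, List.map_cons, ← List.singleton_append]
    congr 1
    simp only [List.filter_map, Function.comp_def]
    have : ∀ b u : Fin 2, (List.finRange 2).filter (fun x => decide (x + u = b)) = [b + u] := by
      decide
    rw [this, List.map_singleton]

/-- A labelling of the edges amounts to a labelling of the edges that end at `L` and one of the
edges that end at `R`. -/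
def labellingEquiv (s : Fin n → Fin 2) (X : Type*) :
    (EdgeLabel n → X) ≃ (Fin n → X) × (Fin n → X) where
  toFun I := (fun k => I (k, s k), fun k => I (k, 1 + s k))
  invFun q e := if e.2 = s e.1 then q.1 e.1 else q.2 e.1
  left_inv I := by
    funext ⟨k, a⟩
    dsimp only
    split_ifs with h
    · rw [h]
    · congr 2
      generalize s k = u at *
      revert u a
      decide
  right_inv q := by
    ext k
    · simp
    · have : ∀ u : Fin 2, 1 + u ≠ u := by decide
      simp [this]

theorem bidiff_ofSwaps {P : PoissonStructure d} {α : Fin d → Fin d → ℝ}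
    (hP : ∀ (i j : Fin d) (x : Space d), P.coeff i j x = α i j) (s : Fin n → Fin 2)
    (f g : Smooth d) :
    (ofSwaps s).bidiff P f g = (-1 : ℝ) ^ (ofSwaps s).numSwapped • moyalTerm α n f g := by
  have hc : ∀ i j, P.coeff i j = algebraMap ℝ (Smooth d) (α i j) := fun i j => by
    ext x
    exact hP i j x
  rw [moyalTerm, ← Fintype.sum_prod_type', Finset.smul_sum, bidiff]
  refine Fintype.sum_equiv (labellingEquiv s (Fin d)) _ _ fun I => ?_
  rw [neg_one_pow_numSwapped_ofSwaps, smul_smul, ← Finset.prod_mul_distrib, Algebra.smul_def,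
    map_prod, ← mul_assoc]
  congr 2
  · refine Finset.prod_congr rfl fun k _ => ?_
    rw [inEdges_ofSwaps_inl, hc]
    change algebraMap ℝ (Smooth d) _ = _
    congr 1
    change _ = _ * α (I (k, s k)) (I (k, 1 + s k))
    generalize s k = u
    fin_cases u
    · simp
    -- At a swapped vertex the indices of `α` appear transposed.
    · simpa using PoissonStructure.skew_of_const hP _ _
  · rw [inEdges_ofSwaps_inr, List.map_map, List.ofFn_eq_map]
    simp [labellingEquiv, Function.comp_def]
  · rw [inEdges_ofSwaps_inr, List.map_map, List.ofFn_eq_map]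
    rfl

end AdmissibleGraph

theorem moyalOp_zero_left (α : Fin d → Fin d → ℝ) (n : ℕ) (g : Smooth d) :
    moyalOp α n 0 g = 0 := by
  simp [moyalOp, moyalTerm, pderivs_zero]

theorem moyalOp_zero_right (α : Fin d → Fin d → ℝ) (n : ℕ) (f : Smooth d) :
    moyalOp α n f 0 = 0 := by
  simp [moyalOp, moyalTerm, pderivs_zero]

/-- Only the term with `a = b = 0` survives; in every other one an argument of `B` is zero. -/
theorem starProduct_C_C {A : Type*} [CommRing A] {B : ℕ → A → A → A}
    (hl : ∀ n g, B n 0 g = 0) (hr : ∀ n f, B n f 0 = 0) (f g : A) :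
    starProduct B (PowerSeries.C f) (PowerSeries.C g) = PowerSeries.mk fun n => B n f g := by
  ext N
  rw [starProduct, PowerSeries.coeff_mk, PowerSeries.coeff_mk,
    Finset.sum_eq_single (N, 0)]
  · simp
  · rintro ⟨a, b⟩ hab hne
    refine Finset.sum_eq_zero ?_
    rintro ⟨u, v⟩ huv
    rw [Finset.HasAntidiagonal.mem_antidiagonal] at hab huv
    rw [PowerSeries.coeff_C, PowerSeries.coeff_C]
    dsimp only at *
    split_ifs with hu hv
    · exact absurd (Prod.ext (by dsimp; omega) (by dsimp; omega)) hne
    · exact hr _ _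
    · exact hl _ _
    · exact hl _ _
  · intro h
    simp at h

end Algebra

end Kontsevich

namespace Kontsevich

/-! ### The weight of a single vertex as the area of a triangle of angles -/

section AngleIntegral

open Complex Set

/-- The open upper half plane, as a subset of `ℂ`. -/
def upperHalf : Set ℂ := {z | 0 < z.im}

theorem measurableSet_upperHalf : MeasurableSet upperHalf :=
  measurableSet_lt measurable_const measurable_im

/-- The density of `dφ_L ∧ dφ_R` for one vertex at `z` in the upper half plane. -/
noncomputable def angleDensity (z : ℂ) : ℝ :=
  1 / Real.pi ^ 2 * (z.im / (normSq z * normSq (z - 1)))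

/-- The pair of angles under which a point is seen from `0` and `1`. -/
noncomputable def argPair (z : ℂ) : ℂ := ⟨arg z, arg (z - 1)⟩

/-- The derivative of `argPair`. -/
noncomputable def argPairDeriv (z : ℂ) : ℂ →L[ℝ] ℂ :=
  (ofRealCLM.comp (imCLM.comp (z⁻¹ • (1 : ℂ →L[ℝ] ℂ)))) +
    I • (ofRealCLM.comp (imCLM.comp ((z - 1)⁻¹ • (1 : ℂ →L[ℝ] ℂ))))

theorem ne_zero_of_im_pos {z : ℂ} (hz : 0 < z.im) : z ≠ 0 := by
  rintro rfl
  simp at hz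

theorem sub_one_im (z : ℂ) : (z - 1).im = z.im := by simp

theorem hasFDerivAt_arg {z : ℂ} (hz : z ∈ slitPlane) :
    HasFDerivAt arg (imCLM.comp (z⁻¹ • (1 : ℂ →L[ℝ] ℂ))) z := by
  have h := imCLM.hasFDerivAt.comp z (hasStrictFDerivAt_log_real hz).hasFDerivAt
  exact h.congr_of_eventuallyEq (Filter.Eventually.of_forall fun w => by simp [log_im])

theorem hasFDerivAt_argPair {z : ℂ} (hz : 0 < z.im) :
    HasFDerivAt argPair (argPairDeriv z) z := by
  have h0 := hasFDerivAt_arg (z := z) (Or.inr hz.ne')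
  have h1 : HasFDerivAt (fun w : ℂ => arg (w - 1))
      (imCLM.comp ((z - 1)⁻¹ • (1 : ℂ →L[ℝ] ℂ))) z :=
    (HasFDerivAt.comp (f := fun w : ℂ => w - 1) z
      (hasFDerivAt_arg (z := z - 1) (Or.inr (by rw [sub_one_im]; exact hz.ne')))
      ((hasFDerivAt_id (𝕜 := ℝ) z).sub_const 1)).congr_fderiv (by ext; simp)
  have h := (ofRealCLM.hasFDerivAt.comp z h0).add
    ((ofRealCLM.hasFDerivAt.comp z h1).const_smul I)
  exact h.congr_of_eventuallyEq (Filter.Eventually.of_forall fun w => by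
    apply Complex.ext <;> simp [argPair])

theorem det_argPairDeriv {z : ℂ} (hz : 0 < z.im) :
    (argPairDeriv z).det = Real.pi ^ 2 * angleDensity z := by
  have h0 := normSq_pos.2 (ne_zero_of_im_pos hz)
  have h1 := normSq_pos.2 (ne_zero_of_im_pos ((sub_one_im z).symm ▸ hz : 0 < (z - 1).im))
  rw [ContinuousLinearMap.det, ← LinearMap.det_toMatrix basisOneI, Matrix.det_fin_two]
  simp only [LinearMap.toMatrix_apply, coe_basisOneI, coe_basisOneI_repr, argPairDeriv,
    angleDensity]
  simp
  field_simp
  ring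

/-- The law of sines in the triangle `0, 1, z`, whose angles at `1` and `z` are `π - arg (z - 1)`
and `arg (z - 1) - arg z`. -/
theorem norm_mul_sin_arg_sub {z : ℂ} (hz : 0 < z.im) :
    ‖z‖ * Real.sin (arg (z - 1) - arg z) = Real.sin (arg (z - 1)) := by
  have hz0 := ne_zero_of_im_pos hz
  have hz1 := ne_zero_of_im_pos ((sub_one_im z).symm ▸ hz : 0 < (z - 1).im)
  have h0 := norm_pos_iff.2 hz0
  have h1 := norm_pos_iff.2 hz1
  rw [Real.sin_sub, sin_arg, sin_arg, cos_arg hz0, cos_arg hz1]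
  field_simp
  simp only [sub_im, sub_re, one_im, one_re]
  ring

theorem arg_pos_of_im_pos {z : ℂ} (hz : 0 < z.im) : 0 < arg z := by
  refine lt_of_le_of_ne (arg_nonneg_iff.2 hz.le) fun h => ?_
  exact hz.ne' (arg_eq_zero_iff.1 h.symm).2

theorem arg_lt_arg_sub_one {z : ℂ} (hz : 0 < z.im) : arg z < arg (z - 1) := by
  have hz1 : 0 < (z - 1).im := (sub_one_im z).symm ▸ hz
  have h := norm_mul_sin_arg_sub hz
  have hsin : 0 < Real.sin (arg (z - 1)) :=
    Real.sin_pos_of_pos_of_lt_pi (arg_pos_of_im_pos hz1) (arg_lt_pi_iff.2 (Or.inr hz1.ne'))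
  rw [← h] at hsin
  by_contra! hle
  have : Real.sin (arg (z - 1) - arg z) ≤ 0 :=
    Real.sin_nonpos_of_nonpos_of_neg_pi_le (by linarith)
      (by linarith [arg_pos_of_im_pos hz1, arg_le_pi z])
  exact absurd hsin (not_lt.2 (mul_nonpos_of_nonneg_of_nonpos (norm_nonneg z) this))

/-- A triangle is determined by the side from `0` to `1` and its two adjacent angles. -/
theorem injOn_argPair : InjOn argPair upperHalf := by
  intro z hz w hw h
  have h0 : arg z = arg w := congrArg re h
  have h1 : arg (z - 1) = arg (w - 1) := congrArg im h
  have hs : 0 < Real.sin (arg (z - 1) - arg z) :=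
    Real.sin_pos_of_pos_of_lt_pi (by linarith [arg_lt_arg_sub_one hz])
      (by linarith [arg_pos_of_im_pos hz, arg_le_pi (z - 1)])
  have hn : ‖z‖ = ‖w‖ := by
    refine mul_right_cancel₀ hs.ne' ?_
    rw [norm_mul_sin_arg_sub hz, h0, h1, norm_mul_sin_arg_sub hw]
  exact Complex.ext_norm_arg hn h0

theorem image_argPair :
    argPair '' upperHalf =
      measurableEquivRealProd ⁻¹' regionBetween id (fun _ => Real.pi) (Ioo 0 Real.pi) := by
  ext w
  simp only [mem_preimage, regionBetween, measurableEquivRealProd_apply, mem_ofPred, mem_Ioo, id]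
  constructor
  · rintro ⟨z, hz, rfl⟩
    exact ⟨⟨arg_pos_of_im_pos hz, arg_lt_pi_iff.2 (Or.inr hz.ne')⟩, arg_lt_arg_sub_one hz,
      arg_lt_pi_iff.2 (Or.inr (by rw [sub_one_im]; exact hz.ne'))⟩
  · rintro ⟨⟨ha, ha'⟩, hab, hb⟩
    obtain ⟨a, b⟩ := w
    dsimp only at *
    have hsa := Real.sin_pos_of_pos_of_lt_pi ha ha'
    have hsb := Real.sin_pos_of_pos_of_lt_pi (ha.trans hab) hb
    have hs := Real.sin_pos_of_pos_of_lt_pi (sub_pos.2 hab) (by linarith)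
    -- By the law of sines the preimage of `(a, b)` has `‖z‖ = sin b / sin (b - a)` and `‖z - 1‖ =
    -- sin a / sin (b - a)`.
    have h1 : ((Real.sin b / Real.sin (b - a) : ℝ) : ℂ) * (cos a + sin a * I) - 1 =
        ((Real.sin a / Real.sin (b - a) : ℝ) : ℂ) * (cos b + sin b * I) := by
      rw [← ofReal_cos, ← ofReal_sin, ← ofReal_cos, ← ofReal_sin]
      apply Complex.ext
      · simp only [sub_re, add_re, ofReal_re, mul_re, I_re, ofReal_im, I_im, one_re]
        field_simp
        rw [Real.sin_sub]
        ring
      · simp only [sub_im, add_im, ofReal_re, mul_im, I_re, ofReal_im, I_im, one_im]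
        field_simp
        ring
    refine ⟨((Real.sin b / Real.sin (b - a) : ℝ) : ℂ) * (cos a + sin a * I), ?_, ?_⟩
    · change 0 < Complex.im _
      rw [← ofReal_cos, ← ofReal_sin, im_ofReal_mul]
      simp only [add_im, ofReal_im, mul_im, ofReal_re, I_im, I_re]
      have := mul_pos (div_pos hsb hs) hsa
      simpa using this
    · rw [argPair, h1, arg_mul_cos_add_sin_mul_I (div_pos hsb hs) ⟨by linarith, by linarith⟩,
        arg_mul_cos_add_sin_mul_I (div_pos hsa hs) ⟨by linarith, by linarith⟩]

theorem volume_image_argPair :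
    volume (argPair '' upperHalf) = ENNReal.ofReal (Real.pi ^ 2 / 2) := by
  have hle : (0 : ℝ) ≤ Real.pi := Real.pi_pos.le
  rw [image_argPair, volume_preserving_equiv_real_prod.measure_preimage_equiv,
    Measure.volume_eq_prod, volume_regionBetween_eq_integral
      (continuous_id.integrableOn_Icc.mono_set Ioo_subset_Icc_self)
      (continuous_const.integrableOn_Icc.mono_set Ioo_subset_Icc_self) measurableSet_Ioo
      fun x hx => hx.2.le]
  congr 1
  rw [← integral_Ioc_eq_integral_Ioo, ← intervalIntegral.integral_of_le hle]
  simp only [Pi.sub_apply, id]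
  rw [intervalIntegral.integral_sub (by simp) (by simp)]
  simp
  ring

theorem abs_det_argPairDeriv {z : ℂ} (hz : z ∈ upperHalf) :
    |(argPairDeriv z).det| = Real.pi ^ 2 * angleDensity z := by
  rw [det_argPairDeriv hz, abs_of_nonneg]
  have : 0 < z.im := hz
  have := normSq_nonneg z
  have := normSq_nonneg (z - 1)
  unfold angleDensity
  positivity

/-- Change of variables makes this equivalent to the image having finite area. -/
theorem integrableOn_angleDensity : IntegrableOn angleDensity upperHalf := by
  have h := (integrableOn_image_iff_integrableOn_abs_det_fderiv_smul volume
    measurableSet_upperHalf (fun z hz => (hasFDerivAt_argPair hz).hasFDerivWithinAt)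
    injOn_argPair (fun _ => (1 : ℝ))).1
      (integrableOn_const (by rw [volume_image_argPair]; exact ENNReal.ofReal_ne_top))
  have h' : IntegrableOn (fun z => Real.pi ^ 2 * angleDensity z) upperHalf :=
    h.congr_fun (fun z hz => by simp [abs_det_argPairDeriv hz]) measurableSet_upperHalf
  exact (integrable_const_mul_iff (IsUnit.mk0 _ (pow_ne_zero 2 Real.pi_ne_zero)) _).1 h'

theorem integral_angleDensity : ∫ z in upperHalf, angleDensity z = 1 / 2 := by
  have h := integral_image_eq_integral_abs_det_fderiv_smul volume
    measurableSet_upperHalf (fun z hz => (hasFDerivAt_argPair hz).hasFDerivWithinAt)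
    injOn_argPair (fun _ => (1 : ℝ))
  rw [setIntegral_congr_fun (g := fun z => Real.pi ^ 2 * angleDensity z) measurableSet_upperHalf
    (fun z hz => by simp [abs_det_argPairDeriv hz]), integral_const_mul] at h
  rw [integral_const, smul_eq_mul, mul_one, measureReal_restrict_apply_univ, Measure.real,
    volume_image_argPair, ENNReal.toReal_ofReal (by positivity)] at h
  have := Real.pi_pos
  have h2 : Real.pi ^ 2 * (∫ z in upperHalf, angleDensity z) = Real.pi ^ 2 * (1 / 2) := by
    rw [← h]; ring
  exact mul_left_cancel₀ (by positivity) h2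

end AngleIntegral

/-! ### The configuration space as a product, up to a null set -/

section ConfigurationSpace

variable {n : ℕ}

theorem configSpace_ae_eq :
    configSpace n =ᵐ[volume] Set.univ.pi fun _ : Fin n => upperHalf := by
  have hsub : configSpace n ⊆ Set.univ.pi fun _ : Fin n => upperHalf := fun p hp k _ => hp.1 k
  refine Filter.EventuallyLE.antisymm hsub.eventuallyLE ?_
  have hdiag : ∀ i j : Fin n, i ≠ j → ∀ᵐ p : Fin n → ℂ, p i ≠ p j := fun i j hij => by
    -- Each diagonal is a proper real subspace, hence null.
    let S : Submodule ℝ (Fin n → ℂ) := LinearMap.ker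
      ((LinearMap.proj i : (Fin n → ℂ) →ₗ[ℝ] ℂ) - LinearMap.proj j)
    have hS : S ≠ ⊤ := fun h => by
      have : (Pi.single i 1 : Fin n → ℂ) ∈ S := h ▸ Submodule.mem_top
      simp [S, LinearMap.mem_ker, hij] at this
    refine measure_mono_null (fun p hp => ?_) (Measure.addHaar_submodule volume S hS)
    have hp' : p i = p j := by simpa using hp
    simp [S, LinearMap.mem_ker, hp']
  have hall : ∀ᵐ p : Fin n → ℂ, ∀ i j : Fin n, i ≠ j → p i ≠ p j := by
    simpa only [ae_all_iff, Filter.eventually_all] using hdiag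
  filter_upwards [hall] with p hp hmem
  exact ⟨fun k => hmem k (Set.mem_univ k), fun i j h => by_contra fun hij => hp i j hij h⟩

theorem measurableSet_configSpace : MeasurableSet (configSpace n) := by
  have : configSpace n = (⋂ k, {p : Fin n → ℂ | 0 < (p k).im}) ∩
      ⋂ i, ⋂ j, {p : Fin n → ℂ | p i = p j → i = j} := by
    ext p
    simp [configSpace, Function.Injective]
  rw [this]
  refine (MeasurableSet.iInter fun k => ?_).inter
    (MeasurableSet.iInter fun i => MeasurableSet.iInter fun j => ?_)
  · exact measurableSet_lt measurable_const (Complex.measurable_im.comp (measurable_pi_apply k))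
  · exact (measurableSet_eq_fun (measurable_pi_apply i) (measurable_pi_apply j)).imp
      (MeasurableSet.const _)

theorem volume_restrict_configSpace :
    (volume : Measure (Fin n → ℂ)).restrict (configSpace n) =
      Measure.pi fun _ => (volume : Measure ℂ).restrict upperHalf := by
  rw [Measure.restrict_congr_set configSpace_ae_eq, volume_pi, Measure.restrict_pi_pi]

end ConfigurationSpace

end Kontsevich

namespace Kontsevich

/-! ### Factorization of the weight form and conclusion -/

section WeightForm

open Complex

variable {n d : ℕ}

/-- The position of the vertex `L` (for `b = 0`) or `R` (for `b = 1`). -/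
def boundaryPoint (b : Fin 2) : ℝ := if b = 0 then 0 else 1

theorem position_inr (p : Fin n → ℂ) (b : Fin 2) :
    position p (Sum.inr b) = (boundaryPoint b : ℂ) := by
  simp only [position, boundaryPoint]
  split_ifs <;> simp

namespace AdmissibleGraph

/-- As `q` is real, the logarithmic derivative of the ratio along `v` is `w - conj w` with `w = v /
(p - q)`. Its imaginary part `2 Im w` absorbs the `2` of `1 / (2π)`. -/
theorem dAngle_apply_of_target_eq_inr {Γ : AdmissibleGraph n} {e : EdgeLabel n} {b : Fin 2}
    (he : Γ.target e = Sum.inr b) {p : Fin n → ℂ} (hp : 0 < (p e.1).im) (v : Fin n → ℂ) :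
    Γ.dAngle e p v = 1 / Real.pi * (v e.1 / (p e.1 - boundaryPoint b)).im := by
  set q : ℂ := (boundaryPoint b : ℂ) with hq
  have hu : Γ.edgeRatio e = fun x => (q - x e.1) / (q - (starRingEnd ℂ) (x e.1)) := by
    funext x
    rw [edgeRatio, angleRatio, he, position_inr]
  have h1 : q - p e.1 ≠ 0 := fun h => by
    have := congrArg im h
    simp [hq] at this
    exact hp.ne' this
  have h2 : q - (starRingEnd ℂ) (p e.1) ≠ 0 := fun h => by
    have := congrArg im h
    simp [hq] at this
    exact hp.ne' this
  have hnum : HasFDerivAt (fun x : Fin n → ℂ => x e.1)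
      (ContinuousLinearMap.proj (R := ℝ) e.1) p :=
    (ContinuousLinearMap.proj (R := ℝ) (φ := fun _ : Fin n => ℂ) e.1).hasFDerivAt
  have hden : HasFDerivAt (fun x : Fin n → ℂ => (starRingEnd ℂ) (x e.1))
      ((conjCLE : ℂ →L[ℝ] ℂ).comp (ContinuousLinearMap.proj (R := ℝ) e.1)) p :=
    ((conjCLE : ℂ →L[ℝ] ℂ).comp
      (ContinuousLinearMap.proj (R := ℝ) (φ := fun _ : Fin n => ℂ) e.1)).hasFDerivAt
  have hinv := (hasFDerivAt_inv' (𝕜 := ℝ) h2).comp p (hden.const_sub q)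
  have h := (hnum.const_sub q).mul hinv
  have hD : HasFDerivAt (Γ.edgeRatio e) _ p :=
    h.congr_of_eventuallyEq (Filter.Eventually.of_forall fun x => by
      simp [hu, div_eq_mul_inv])
  have hval : (Γ.edgeRatio e p)⁻¹ * fderiv ℝ (Γ.edgeRatio e) p v =
      v e.1 / (p e.1 - q) - (starRingEnd ℂ) (v e.1 / (p e.1 - q)) := by
    rw [hD.fderiv, hu]
    have h3 : p e.1 - q ≠ 0 := fun h => h1 (by rw [← neg_sub, h, neg_zero])
    have h4 : (starRingEnd ℂ) (p e.1) - q ≠ 0 := fun h => h2 (by rw [← neg_sub, h, neg_zero])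
    have hqc : (starRingEnd ℂ) q = q := conj_ofReal _
    simp only [map_div₀, map_sub, hqc]
    simp
    field_simp
    ring
  have himag : ∀ w : ℂ, (w - (starRingEnd ℂ) w).im = 2 * w.im := fun w => by simp; ring
  change (1 / (2 * Real.pi)) * ((Γ.edgeRatio e p)⁻¹ * fderiv ℝ (Γ.edgeRatio e) p v).im = _
  rw [hval, himag]
  have := Real.pi_ne_zero
  field_simp

/-- An edge at `l` has a differential that sees only the directions of `p_l`, so the matrix is block
diagonal with one 2 × 2 block per vertex. A swap exchanges the columns of its block. -/
theorem weightForm_ofSwaps_frame (s : Fin n → Fin 2) {p : Fin n → ℂ} (hp : ∀ k, 0 < (p k).im) :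
    (ofSwaps s).weightForm p (frame n) =
      (-1) ^ (ofSwaps s).numSwapped * ∏ k, angleDensity (p k) := by
  let M : Fin n → Matrix (Fin 2) (Fin 2) ℝ := fun k => Matrix.of fun a b =>
    1 / Real.pi * ((if a = 0 then 1 else I) / (p k - boundaryPoint (b + s k))).im
  have hM : (ofSwaps s).weightForm p (frame n) = (Matrix.blockDiagonal M).det := by
    -- `Matrix.blockDiagonal` puts the block index second; permuting rows and columns alike
    -- preserves the determinant.
    rw [← Matrix.det_submatrix_equiv_self (Equiv.prodComm (Fin n) (Fin 2))]
    change Matrix.det _ = _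
    congr 1
    ext ⟨k, a⟩ ⟨l, b⟩
    change (ofSwaps s).dAngle (l, b) p (frame n (k, a)) = _
    rw [dAngle_apply_of_target_eq_inr (target_ofSwaps s (l, b)) (hp l)]
    rw [Matrix.submatrix_apply, Equiv.prodComm_apply, Equiv.prodComm_apply, Prod.swap, Prod.swap,
      Matrix.blockDiagonal_apply]
    dsimp only [frame]
    by_cases h : k = l
    · subst h
      simp [M]
    · rw [if_neg h, Pi.single_eq_of_ne (Ne.symm h)]
      simp
  rw [hM, Matrix.det_blockDiagonal, neg_one_pow_numSwapped_ofSwaps, ← Finset.prod_mul_distrib]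
  refine Finset.prod_congr rfl fun k _ => ?_
  have h0 := normSq_pos.2 (ne_zero_of_im_pos (hp k))
  have h1 := normSq_pos.2
    (ne_zero_of_im_pos ((sub_one_im (p k)).symm ▸ hp k : 0 < (p k - 1).im))
  have hpi := Real.pi_ne_zero
  rw [Matrix.det_fin_two]
  simp only [M, Matrix.of_apply, angleDensity]
  generalize s k = u
  fin_cases u <;>
  · simp [boundaryPoint, div_im]
    field_simp
    ring

theorem integrableOn_weightForm_ofSwaps (s : Fin n → Fin 2) :
    IntegrableOn (fun p => (ofSwaps s).weightForm p (frame n)) (configSpace n) := by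
  have h : IntegrableOn (fun p : Fin n → ℂ =>
      (-1) ^ (ofSwaps s).numSwapped * ∏ k, angleDensity (p k)) (configSpace n) := by
    rw [IntegrableOn, volume_restrict_configSpace]
    exact (Integrable.fintype_prod fun _ => integrableOn_angleDensity).const_mul _
  exact h.congr_fun (fun p hp => (weightForm_ofSwaps_frame s hp.1).symm) measurableSet_configSpace

theorem weight_ofSwaps (s : Fin n → Fin 2) :
    (ofSwaps s).weight = (-1) ^ (ofSwaps s).numSwapped * (1 / 2) ^ n := by
  rw [weight, setIntegral_congr_fun measurableSet_configSpace
    (fun p hp => weightForm_ofSwaps_frame s hp.1), integral_const_mul,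
    volume_restrict_configSpace, integral_fintype_prod_eq_pow, integral_angleDensity,
    Fintype.card_fin]

theorem moyal_eq_ofSwaps (n : ℕ) : moyal n = ofSwaps fun _ => 0 :=
  Subtype.ext (funext fun e => by simp [moyal, ofSwaps])

theorem weight_moyal (n : ℕ) : (moyal n).weight = (1 / 2) ^ n := by
  have h := neg_one_pow_numSwapped_ofSwaps (fun _ : Fin n => 0)
  rw [moyal_eq_ofSwaps, weight_ofSwaps, h]
  simp

theorem weight_smul_bidiff {P : PoissonStructure d} {α : Fin d → Fin d → ℝ}
    (hP : ∀ (i j : Fin d) (x : Space d), P.coeff i j x = α i j) {Γ : AdmissibleGraph n}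
    (hΓ : Γ.AllEdgesToLR) (f g : Smooth d) :
    Γ.weight • Γ.bidiff P f g = ((1 / 2 : ℝ) ^ n) • moyalTerm α n f g := by
  obtain ⟨s, rfl⟩ := hΓ.exists_ofSwaps
  rw [weight_ofSwaps, bidiff_ofSwaps hP, smul_smul, mul_right_comm, ← mul_pow]
  simp

end AdmissibleGraph

theorem kontsevichOp_eq_moyalOp {P : PoissonStructure d} {α : Fin d → Fin d → ℝ}
    (hP : ∀ (i j : Fin d) (x : Space d), P.coeff i j x = α i j) :
    kontsevichOp P = moyalOp α := by
  classical
  funext n f g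
  rw [kontsevichOp, moyalOp]
  congr 1
  -- The `2 ^ n` equal terms cancel the factor `(1 / 2) ^ n`.
  rw [← Finset.sum_filter_add_sum_filter_not Finset.univ AdmissibleGraph.AllEdgesToLR,
    Finset.sum_congr rfl fun Γ hΓ =>
      AdmissibleGraph.weight_smul_bidiff hP (Finset.mem_filter.1 hΓ).2 f g,
    Finset.sum_eq_zero (s := Finset.univ.filter fun Γ => ¬ AdmissibleGraph.AllEdgesToLR Γ)
      fun Γ hΓ => by
        rw [AdmissibleGraph.bidiff_eq_zero hP (Finset.mem_filter.1 hΓ).2, smul_zero],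
    Finset.sum_const, add_zero, ← Fintype.card_subtype, ← Nat.card_eq_fintype_card,
    AdmissibleGraph.card_allEdgesToLR, ← Nat.cast_smul_eq_nsmul ℝ, smul_smul, Nat.cast_pow,
    ← mul_pow]
  simp

end WeightForm

end Kontsevich

theorem proposition5p2 (d : ℕ) (P : PoissonStructure d) (α : Fin d → Fin d → ℝ)
    (hP : ∀ (i j : Fin d) (x : Space d), P.coeff i j x = α i j) :
    -- the two products agree, on functions order by order and on formal power series
    (∀ f g : Smooth d, kontsevichStar P (PowerSeries.C f) (PowerSeries.C g) =
      PowerSeries.mk fun n => (1 / (n.factorial : ℝ)) • moyalTerm α n f g) ∧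
    (∀ F G : PowerSeries (Smooth d), kontsevichStar P F G = moyalStar α F G) ∧
    -- graphs with an edge that ends elsewhere than at `L` or `R` do not contribute
    (∀ (n : ℕ) (Γ : AdmissibleGraph n), ¬ Γ.AllEdgesToLR → ∀ f g : Smooth d, Γ.bidiff P f g = 0) ∧
    -- there are `2 ^ n` remaining graphs
    (∀ n : ℕ, Nat.card {Γ : AdmissibleGraph n // Γ.AllEdgesToLR} = 2 ^ n) ∧
    -- their weights: the integral converges absolutely, factorizes, and is `± (1/2) ^ n`
    (∀ (n : ℕ) (Γ : AdmissibleGraph n), Γ.AllEdgesToLR →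
      IntegrableOn (fun p => Γ.weightForm p (frame n)) (configSpace n) ∧
      Γ.weight = (-1) ^ Γ.numSwapped * (AdmissibleGraph.moyal 1).weight ^ n ∧
      Γ.weight = (-1) ^ Γ.numSwapped * (1 / 2) ^ n) ∧
    -- they all give the same contribution
    (∀ (n : ℕ) (Γ : AdmissibleGraph n), Γ.AllEdgesToLR → ∀ f g : Smooth d,
      Γ.weight • Γ.bidiff P f g = ((1 / 2 : ℝ) ^ n) • moyalTerm α n f g) := by

  have hop := kontsevichOp_eq_moyalOp hP
  refine ⟨fun f g => ?_, fun F G => ?_, fun n Γ hΓ f g => AdmissibleGraph.bidiff_eq_zero hP hΓ f g,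
    AdmissibleGraph.card_allEdgesToLR, fun n Γ hΓ => ?_,
    fun n Γ hΓ f g => AdmissibleGraph.weight_smul_bidiff hP hΓ f g⟩
  · rw [kontsevichStar, hop]
    exact starProduct_C_C (moyalOp_zero_left α) (moyalOp_zero_right α) f g
  · rw [kontsevichStar, hop, moyalStar]
  · obtain ⟨s, rfl⟩ := hΓ.exists_ofSwaps
    -- With `ω_{Γ₁} = 1 / 2` the factorized and the explicit value coincide.
    rw [AdmissibleGraph.weight_moyal, pow_one]
    exact ⟨AdmissibleGraph.integrableOn_weightForm_ofSwaps s, AdmissibleGraph.weight_ofSwaps s,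
      AdmissibleGraph.weight_ofSwaps s⟩
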